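/- Let $t\ge 1$ be an integer and let $f\in\mathbb R[Z]^{t\times t}$ be a symmetric matrix polynomial ($f=f^*$) in one variable $Z$, where $p^*$ denotes the transpose of a matrix $p$ over $\mathbb R[Z]$. A real $t\times t$ matrix $A$ is called negative semidefinite if $-A$ is positive semidefinite, and a sum of hermitian squares is a finite sum $\sum_j q_j^*q_j$ with $q_j\in\mathbb R[Z]^{t\times t}$. The following are equivalent: (i) for every $x\in\mathbb R$, the matrix $f(x)$ is not negative semidefinite; (ii) there exist finitely many $p_i\in\mathbb R[Z]^{t\times t}$ such that $\sum_i p_i^*fp_i-1$ is a sum of hermitian squares, where $1$ denotes the identity matrix. -/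

import Mathlib

open scoped Matrix Polynomial

/-- The value `f(x) ∈ ℝ^{t×t}` of a univariate real matrix polynomial `f ∈ ℝ[Z]^{t×t}` at `x`. -/
noncomputable def MatPoly.evalAt {t : ℕ} (f : Matrix (Fin t) (Fin t) ℝ[X]) (x : ℝ) :
    Matrix (Fin t) (Fin t) ℝ :=
  f.map (Polynomial.eval x)

/-- A real square matrix `A` is negative semidefinite if `-A` is positive semidefinite. -/
def Matrix.IsNegSemidef {t : ℕ} (A : Matrix (Fin t) (Fin t) ℝ) : Prop :=
  (-A).PosSemidef

/-- `g` is a (finite) sum of hermitian squares `q* q` with `q ∈ ℝ[Z]^{t×t}`. The involution on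
`ℝ[Z]` is trivial, so `q*` is the transpose of `q`. -/
def MatPoly.IsSumHermitianSquares {t : ℕ} (g : Matrix (Fin t) (Fin t) ℝ[X]) : Prop :=
  ∃ (m : ℕ) (q : Fin m → Matrix (Fin t) (Fin t) ℝ[X]), g = ∑ j, (q j)ᵀ * q j

open scoped Matrix Polynomial
open Filter Topology

/-! ### Nonnegative polynomials on the line, and signs near ±∞ -/

namespace Polynomial

/-! Let `S` be the set of finite sums of `vᵀ f v` over polynomial vectors `v`; it is stable under
multiplication by squares. If no `f(x)` is negative semidefinite, each point has a member of `S`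
positive there, and diagonalizing `f` over `ℝ(Z)` gives members positive near each end of the line.
Weierstrass approximation on a compact interval and a member tending to `+∞` at both ends glue these
into some `g ∈ S` positive on all of `ℝ`.

Rank-one matrices `p = v eₖᵀ` turn `g • 1` into a sum of `pᵀ f p`. Scaled to have minimum 1, `g - 1`
is nonnegative, hence a sum of squares. The converse evaluates at a point and compares signs. -/

theorem exists_forall_eval_le_of_nonneg (p : ℝ[X]) (hp : ∀ x, 0 ≤ p.eval x) :
    ∃ a, ∀ x, p.eval a ≤ p.eval x := by
  obtain ⟨a, ha⟩ := p.exists_forall_norm_le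
  refine ⟨a, fun x => ?_⟩
  simpa [abs_of_nonneg (hp _)] using ha x

theorem X_sub_C_sq_dvd_of_nonneg {p : ℝ[X]} (hp : ∀ x, 0 ≤ p.eval x) {a : ℝ}
    (ha : p.eval a = 0) : (X - C a) ^ 2 ∣ p := by
  obtain ⟨q, rfl⟩ := dvd_iff_isRoot.2 ha
  rw [pow_two]
  refine mul_dvd_mul_left _ (dvd_iff_isRoot.2 ?_)
  have hmin : IsLocalMin (fun x => ((X - C a) * q).eval x) a :=
    Eventually.of_forall fun x => ha.trans_le (hp x)
  have h := hmin.deriv_eq_zero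
  rw [Polynomial.deriv] at h
  simpa [derivative_mul] using h

/-- A univariate real polynomial that is nonnegative on the real line is a sum of squares. -/
theorem isSumSq_of_eval_nonneg (p : ℝ[X]) (hp : ∀ x, 0 ≤ p.eval x) : IsSumSq p := by
  induction hn : p.natDegree using Nat.strong_induction_on generalizing p with
  | _ n ih =>
    obtain ⟨a, ha⟩ := exists_forall_eval_le_of_nonneg p hp
    have hr : ∀ x, 0 ≤ (p - C (p.eval a)).eval x := fun x => by simpa using ha x
    obtain ⟨q, hq⟩ := X_sub_C_sq_dvd_of_nonneg hr (a := a) (by simp)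
    -- The minimum value is a square, and the remainder has a double root at the minimizer, so the
    -- cofactor `q` has degree two less.
    have hpq : p = C √(p.eval a) * C √(p.eval a) + (X - C a) * (X - C a) * q := by
      rw [← C_mul, Real.mul_self_sqrt (hp a), ← pow_two, ← hq]; ring
    suffices hqs : IsSumSq q by
      rw [hpq]
      exact (IsSumSq.mul_self _).add ((IsSumSq.mul_self _).mul hqs)
    by_cases hq0 : q = 0
    · rw [hq0]; exact IsSumSq.zero
    · refine ih q.natDegree ?_ q ?_ rfl
      · have h1 := congrArg natDegree hq
        rw [natDegree_sub_C, natDegree_mul (pow_ne_zero _ (X_sub_C_ne_zero a)) hq0,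
          natDegree_pow, natDegree_X_sub_C] at h1
        omega
      · have hne : ∀ x ≠ a, 0 ≤ q.eval x := fun x hx => by
          have h1 := hr x
          rw [hq] at h1
          simp only [eval_mul, eval_pow, eval_sub, eval_X, eval_C] at h1
          exact nonneg_of_mul_nonneg_right h1 (by have := sub_ne_zero.2 hx; positivity)
        have hd : Dense {x : ℝ | x ≠ a} := dense_compl_singleton a
        intro x
        have hcl : IsClosed {x | 0 ≤ q.eval x} := isClosed_le continuous_const q.continuous
        exact (hcl.closure_subset_iff.2 fun x hx => hne x hx) (hd x)

theorem tendsto_atBot_iff_comp_neg_X {p : ℝ[X]} :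
    Tendsto (fun x => p.eval x) atBot atTop ↔
      Tendsto (fun x => (p.comp (-X)).eval x) atTop atTop := by
  simp only [eval_comp, eval_neg, eval_X]
  exact ⟨fun h => h.comp tendsto_neg_atTop_atBot, fun h => by
    simpa [Function.comp_def] using h.comp tendsto_neg_atBot_atTop⟩

theorem leadingCoeff_comp_neg_X (p : ℝ[X]) :
    (p.comp (-X)).leadingCoeff = (-1) ^ p.natDegree * p.leadingCoeff := by
  rw [leadingCoeff_comp (by simp)]; simp [mul_comm]

theorem tendsto_of_even_natDegree {p : ℝ[X]} (he : Even p.natDegree) (h0 : 0 < p.natDegree)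
    (hl : 0 ≤ p.leadingCoeff) :
    Tendsto (fun x => p.eval x) atTop atTop ∧ Tendsto (fun x => p.eval x) atBot atTop := by
  refine ⟨p.tendsto_atTop_of_leadingCoeff_nonneg (natDegree_pos_iff_degree_pos.1 h0) hl, ?_⟩
  rw [tendsto_atBot_iff_comp_neg_X]
  refine tendsto_atTop_of_leadingCoeff_nonneg _ (natDegree_pos_iff_degree_pos.1 ?_) ?_
  · simpa [natDegree_comp] using h0
  · rw [leadingCoeff_comp_neg_X, he.neg_one_pow, one_mul]; exact hl

theorem leadingCoeff_pos_of_eventually_pos {p : ℝ[X]} (h : ∀ᶠ x in atTop, 0 < p.eval x) :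
    0 < p.leadingCoeff := by
  by_contra! hl
  have hneg : ∀ᶠ x in atTop, p.eval x ≤ 0 := by
    by_cases hd : 0 < p.degree
    · exact (p.tendsto_atBot_of_leadingCoeff_nonpos hd hl).eventually_le_atBot 0
    · rw [eq_C_of_degree_le_zero (not_lt.1 hd)] at hl ⊢
      exact Eventually.of_forall fun x => by simpa using hl
  obtain ⟨x, hx, hx'⟩ := (h.and hneg).exists
  exact hx.not_ge hx'

theorem eventually_nonpos_of_not_eventually_pos {p : ℝ[X]} (h : ¬ ∀ᶠ x in atTop, 0 < p.eval x) :
    ∀ᶠ x in atTop, p.eval x ≤ 0 := by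
  by_cases hd : 0 < p.degree
  · by_cases hl : 0 ≤ p.leadingCoeff
    · exact (h ((p.tendsto_atTop_of_leadingCoeff_nonneg hd hl).eventually_gt_atTop 0)).elim
    · exact (p.tendsto_atBot_of_leadingCoeff_nonpos hd (not_le.1 hl).le).eventually_le_atBot 0
  · rw [eq_C_of_degree_le_zero (not_lt.1 hd)] at h ⊢
    simp only [eval_C, eventually_const, not_lt] at h ⊢
    exact h

theorem neg_one_pow_mul_leadingCoeff_pos {p : ℝ[X]} (h : ∀ᶠ x in atBot, 0 < p.eval x) :
    0 < (-1) ^ p.natDegree * p.leadingCoeff := by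
  rw [← leadingCoeff_comp_neg_X]
  refine leadingCoeff_pos_of_eventually_pos ?_
  simpa using tendsto_neg_atTop_atBot.eventually h

/-- If a set of polynomials closed under addition and under multiplication by squares has one
member positive near `+∞` and one positive near `-∞`, then it has a member tending to `+∞` at both
ends. -/
theorem exists_tendsto_of_eventually_pos {S : AddSubmonoid ℝ[X]}
    (hS : ∀ q : ℝ[X], ∀ g ∈ S, q ^ 2 * g ∈ S)
    {g₁ g₂ : ℝ[X]} (hg₁ : g₁ ∈ S) (hg₂ : g₂ ∈ S) (h₁ : ∀ᶠ x in atTop, 0 < g₁.eval x)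
    (h₂ : ∀ᶠ x in atBot, 0 < g₂.eval x) :
    ∃ h ∈ S, Tendsto (fun x => h.eval x) atTop atTop ∧ Tendsto (fun x => h.eval x) atBot atTop := by
  have hl₁ := leadingCoeff_pos_of_eventually_pos h₁
  have hl₂ := neg_one_pow_mul_leadingCoeff_pos h₂
  have even_case : ∀ g ∈ S, Even g.natDegree → 0 < g.leadingCoeff →
      ∃ h ∈ S, Tendsto (fun x => h.eval x) atTop atTop ∧
        Tendsto (fun x => h.eval x) atBot atTop := by
    intro g hg he hl
    have hg0 : g ≠ 0 := by rintro rfl; simp at hl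
    -- The factor `X ^ 2` keeps the degree even and makes it positive even when `g` is constant.
    have hdeg : (X ^ 2 * g).natDegree = 2 + g.natDegree := by
      rw [natDegree_mul (pow_ne_zero _ X_ne_zero) hg0, natDegree_X_pow]
    refine ⟨X ^ 2 * g, hS _ _ hg, tendsto_of_even_natDegree ?_ ?_ ?_⟩
    · rw [hdeg]; exact even_two.add he
    · omega
    · simpa using hl.le
  rcases Nat.even_or_odd' g₁.natDegree with ⟨m, hm | hm⟩
  · exact even_case g₁ hg₁ (hm ▸ even_two_mul m) hl₁
  rcases Nat.even_or_odd' g₂.natDegree with ⟨n, hn | hn⟩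
  · exact even_case g₂ hg₂ (hn ▸ even_two_mul n) (by simpa [hn] using hl₂)
  have hl₂ : 0 < -g₂.leadingCoeff := by simpa [hn, pow_succ] using hl₂
  -- Both degrees are odd. `A` and `B` are scaled to the common odd degree `d + 1` with opposite
  -- leading coefficients `±αβ`. In `(X + c)² A + (X - c)² B` the top terms cancel, and the
  -- coefficient of the even degree `d + 2` is `u + 4cαβ`, positive for large `c`.
  set α := g₁.leadingCoeff with hα
  set β := -g₂.leadingCoeff with hβ
  set A : ℝ[X] := C β * (X ^ (2 * n) * g₁) with hA
  set B : ℝ[X] := C α * (X ^ (2 * m) * g₂) with hB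
  set d := 2 * (m + n) with hd
  set u := (A + B).coeff d with hu
  have hαβ : 0 < α * β := mul_pos hl₁ hl₂
  obtain ⟨c, hc⟩ : ∃ c : ℝ, 0 < u + 4 * c * (α * β) :=
    ⟨(|u| + 1) / (4 * (α * β)), by
      have : u + 4 * ((|u| + 1) / (4 * (α * β))) * (α * β) = u + |u| + 1 := by field_simp; ring
      linarith [neg_abs_le u]⟩
  have sq_C : ∀ r : ℝ, 0 < r → (C r : ℝ[X]) = C √r ^ 2 := fun r hr => by
    rw [← C_pow, Real.sq_sqrt hr.le]
  have hAS : A ∈ S := by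
    rw [hA, sq_C β hl₂]; exact hS _ _ (by rw [mul_comm 2, pow_mul]; exact hS _ _ hg₁)
  have hBS : B ∈ S := by
    rw [hB, sq_C α hl₁]; exact hS _ _ (by rw [mul_comm 2, pow_mul]; exact hS _ _ hg₂)
  have hAd : A.natDegree ≤ d + 1 := by
    refine (natDegree_C_mul_le _ _).trans (natDegree_mul_le.trans ?_)
    rw [natDegree_X_pow]; omega
  have hBd : B.natDegree ≤ d + 1 := by
    refine (natDegree_C_mul_le _ _).trans (natDegree_mul_le.trans ?_)
    rw [natDegree_X_pow]; omega
  have hAc : A.coeff (d + 1) = α * β := by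
    rw [hA, coeff_C_mul, show d + 1 = g₁.natDegree + 2 * n by omega, coeff_X_pow_mul, mul_comm]
    rfl
  have hBc : B.coeff (d + 1) = -(α * β) := by
    rw [hB, coeff_C_mul, show d + 1 = g₂.natDegree + 2 * m by omega, coeff_X_pow_mul, hβ]
    simp
  set T : ℝ[X] := (X + C c) ^ 2 * A + (X - C c) ^ 2 * B with hT
  have hT' : T = X ^ 2 * (A + B) + C (2 * c) * (X * (A - B)) + C (c ^ 2) * (A + B) := by
    rw [hT]; simp only [C_mul, C_pow, C_ofNat]; ring
  have hABd : (A + B).natDegree ≤ d := by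
    rw [natDegree_le_iff_coeff_eq_zero]
    intro k hk
    rcases (Nat.succ_le_iff.2 hk).eq_or_lt with rfl | hk
    · rw [coeff_add, Nat.succ_eq_add_one, hAc, hBc]; ring
    · rw [coeff_add, coeff_eq_zero_of_natDegree_lt (hAd.trans_lt hk),
        coeff_eq_zero_of_natDegree_lt (hBd.trans_lt hk), add_zero]
  have hTc : T.coeff (d + 2) = u + 4 * c * (α * β) := by
    rw [hT', coeff_add, coeff_add, coeff_X_pow_mul, coeff_C_mul, coeff_C_mul, coeff_X_mul,
      coeff_sub, hAc, hBc, coeff_eq_zero_of_natDegree_lt (p := A + B) (n := d + 2) (by omega)]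
    ring
  have hTd : T.natDegree = d + 2 := by
    refine le_antisymm ?_ (le_natDegree_of_ne_zero (by rw [hTc]; exact hc.ne'))
    rw [hT']
    refine natDegree_add_le_of_degree_le (natDegree_add_le_of_degree_le ?_ ?_) ?_
    · refine natDegree_mul_le.trans ?_
      rw [natDegree_X_pow]; omega
    · refine (natDegree_C_mul_le _ _).trans (natDegree_mul_le.trans ?_)
      have := natDegree_sub_le_of_le hAd hBd
      rw [natDegree_X]; omega
    · exact (natDegree_C_mul_le _ _).trans (by omega)
  refine ⟨T, S.add_mem (hS _ _ hAS) (hS _ _ hBS), tendsto_of_even_natDegree ?_ ?_ ?_⟩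
  · rw [hTd]; exact (even_two_mul _).add even_two
  · omega
  · rw [leadingCoeff, hTd, hTc]; exact hc.le

end Polynomial

/-! ### Gluing local positivity into positivity on the whole line -/

namespace Polynomial

theorem exists_abs_eval_le_mul_pow (p : ℝ[X]) {c : ℝ} (hc : 0 < c) :
    ∃ A, ∀ x, 1 ≤ c * |x| → |p.eval x| ≤ A * (c * |x|) ^ p.natDegree := by
  refine ⟨∑ i ∈ Finset.range (p.natDegree + 1), |p.coeff i| * (c⁻¹) ^ i, fun x hx => ?_⟩
  rw [eval_eq_sum_range, Finset.sum_mul]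
  refine (Finset.abs_sum_le_sum_abs _ _).trans (Finset.sum_le_sum fun i hi => ?_)
  have h1 : |p.coeff i * x ^ i| = |p.coeff i| * (c⁻¹) ^ i * (c * |x|) ^ i := by
    rw [abs_mul, abs_pow, mul_assoc, ← mul_pow, inv_mul_cancel_left₀ hc.ne']
  rw [h1]
  exact mul_le_mul_of_nonneg_left
    (pow_le_pow_right₀ hx (Nat.lt_succ_iff.1 (Finset.mem_range.1 hi))) (by positivity)

/-- On a compact interval, some square multiple `q ^ 2 * g` is almost as large as the cube of the
positive part of `g`. -/
theorem exists_sq_mul_gt (g : ℝ[X]) (a b : ℝ) {δ : ℝ} (hδ : 0 < δ) :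
    ∃ q : ℝ[X], ∀ x ∈ Set.Icc a b, (max (g.eval x) 0) ^ 3 - δ ≤ (q ^ 2 * g).eval x := by
  obtain ⟨M, hM⟩ := isCompact_Icc.exists_bound_of_continuousOn (s := Set.Icc a b)
    g.continuous.continuousOn
  simp only [Real.norm_eq_abs] at hM
  set N := |M| + 1 with hN
  have hN0 : 0 < N := by positivity
  set η := min 1 (δ / ((2 * N + 1) * N)) with hη
  have hη0 : 0 < η := lt_min one_pos (by positivity)
  -- With `q` close to the positive part `r` of `g`, `q² g` is close to `r² g = r³`. The error is
  -- `(q - r)(q + r)g`, at most `η (2N + 1) N`.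
  obtain ⟨q, hq⟩ := exists_polynomial_near_of_continuousOn a b (fun x => max (g.eval x) 0)
    (g.continuous.max continuous_const).continuousOn η hη0
  refine ⟨q, fun x hx => ?_⟩
  have hgM : |g.eval x| ≤ N := (hM x hx).trans (by linarith [le_abs_self M])
  have hqx := hq x hx
  set r := max (g.eval x) 0 with hr
  have hr0 : 0 ≤ r := le_max_right _ _
  have hrN : r ≤ N := max_le ((le_abs_self _).trans hgM) hN0.le
  have hrg : r ^ 3 = r ^ 2 * g.eval x := by
    rcases le_total (g.eval x) 0 with h | h
    · rw [hr, max_eq_right h]; ring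
    · rw [hr, max_eq_left h]; ring
  have h1 : |q.eval x + r| ≤ 2 * N + 1 := by
    have e : q.eval x + r = (q.eval x - r) + 2 * r := by ring
    rw [e]
    refine (abs_add_le _ _).trans ?_
    rw [abs_of_nonneg (a := 2 * r) (by linarith)]
    linarith [min_le_left 1 (δ / ((2 * N + 1) * N))]
  have h2 : |(q.eval x - r) * (q.eval x + r) * g.eval x| ≤ δ := by
    rw [abs_mul, abs_mul]
    calc _ ≤ η * (2 * N + 1) * N := by gcongr
      _ = η * ((2 * N + 1) * N) := by ring
      _ ≤ δ / ((2 * N + 1) * N) * ((2 * N + 1) * N) := by gcongr; exact min_le_right _ _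
      _ = δ := by field_simp
  have h3 : (q ^ 2 * g).eval x = r ^ 3 + (q.eval x - r) * (q.eval x + r) * g.eval x := by
    rw [hrg, eval_mul, eval_pow]; ring
  rw [h3]
  linarith [neg_abs_le ((q.eval x - r) * (q.eval x + r) * g.eval x)]

variable {S : AddSubmonoid ℝ[X]}

/-- A plain sum over a finite subcover could fail, since a member may be very negative elsewhere.
Square multipliers nearly replace each `g` by the cube of its positive part, and those cubes have a
sum bounded below by some `ε > 0`. -/
theorem exists_pos_on_Icc (hS : ∀ q : ℝ[X], ∀ g ∈ S, q ^ 2 * g ∈ S)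
    (hpos : ∀ x : ℝ, ∃ g ∈ S, 0 < g.eval x) (a b : ℝ) :
    ∃ p ∈ S, ∀ x ∈ Set.Icc a b, 0 < p.eval x := by
  obtain ⟨s, hs⟩ := isCompact_Icc.elim_finite_subcover (s := Set.Icc a b)
    (fun g : S => {x : ℝ | 0 < (g : ℝ[X]).eval x})
    (fun g => isOpen_lt continuous_const (g : ℝ[X]).continuous)
    (fun x _ => by
      obtain ⟨g, hg, hx⟩ := hpos x
      exact Set.mem_iUnion.2 ⟨⟨g, hg⟩, hx⟩)
  set F : ℝ → ℝ := fun x => ∑ g ∈ s, (max ((g : ℝ[X]).eval x) 0) ^ 3 with hF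
  have hFpos : ∀ x ∈ Set.Icc a b, 0 < F x := fun x hx => by
    obtain ⟨g, hg, hgx⟩ := Set.mem_iUnion₂.1 (hs hx)
    exact Finset.sum_pos' (fun g _ => pow_nonneg (le_max_right _ _) 3)
      ⟨g, hg, pow_pos (lt_max_of_lt_left hgx) 3⟩
  have hFc : Continuous F := continuous_finsetSum _ fun g _ =>
    ((g : ℝ[X]).continuous.max continuous_const).pow 3
  obtain ⟨ε, hε, hFε⟩ : ∃ ε > 0, ∀ x ∈ Set.Icc a b, ε ≤ F x :=
    isCompact_Icc.exists_forall_le' hFc.continuousOn hFpos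
  have hδ : 0 < ε / (s.card + 1) := by positivity
  choose q hq using fun g : S => exists_sq_mul_gt (g : ℝ[X]) a b hδ
  refine ⟨∑ g ∈ s, q g ^ 2 * (g : ℝ[X]), S.sum_mem fun g _ => hS _ _ g.2, fun x hx => ?_⟩
  have h1 : F x - s.card * (ε / (s.card + 1)) ≤ (∑ g ∈ s, q g ^ 2 * (g : ℝ[X])).eval x := by
    rw [eval_finsetSum, hF, ← nsmul_eq_mul, ← Finset.sum_const, ← Finset.sum_sub_distrib]
    exact Finset.sum_le_sum fun g _ => hq g x hx
  have h2 : s.card * (ε / (s.card + 1)) < ε := by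
    rw [← mul_div_assoc, div_lt_iff₀ (by positivity)]; linarith
  linarith [hFε x hx]

/-- Take `P + (cx)^(2N) h` with `P` positive on `[-(R+1), R+1]`, `h ≥ 1` where `|x| ≥ R`, and `c =
1/(R + 1/2)`. For large `N` the second term is negligible on `|x| ≤ R` and dominates `P` on `|x| ≥ R
+ 1`; in between, both terms are positive. -/
theorem exists_forall_eval_pos (hS : ∀ q : ℝ[X], ∀ g ∈ S, q ^ 2 * g ∈ S)
    (hpos : ∀ x : ℝ, ∃ g ∈ S, 0 < g.eval x) {h : ℝ[X]} (hh : h ∈ S)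
    (htop : Tendsto (fun x => h.eval x) atTop atTop)
    (hbot : Tendsto (fun x => h.eval x) atBot atTop) :
    ∃ p ∈ S, ∀ x, 0 < p.eval x := by
  obtain ⟨R, hR0, hR⟩ : ∃ R : ℝ, 0 < R ∧ ∀ x, R ≤ |x| → 1 ≤ h.eval x := by
    obtain ⟨a, ha⟩ := eventually_atTop.1 (htop.eventually_ge_atTop 1)
    obtain ⟨b, hb⟩ := eventually_atBot.1 (hbot.eventually_ge_atTop 1)
    refine ⟨max 1 (max a (-b)), by positivity, fun x hx => ?_⟩
    rcases le_abs.1 ((le_max_right _ _).trans hx) with hx | hx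
    · exact ha x ((le_max_left _ _).trans hx)
    · exact hb x (by linarith [le_max_right a (-b)])
  obtain ⟨P, hPS, hP⟩ := exists_pos_on_Icc hS hpos (-(R + 1)) (R + 1)
  obtain ⟨ε, hε, hPε⟩ : ∃ ε > 0, ∀ x ∈ Set.Icc (-(R + 1)) (R + 1), ε ≤ P.eval x :=
    isCompact_Icc.exists_forall_le' P.continuous.continuousOn hP
  obtain ⟨B, hB⟩ := isCompact_Icc.exists_bound_of_continuousOn (s := Set.Icc (-(R + 1)) (R + 1))
    h.continuous.continuousOn
  set c := (R + 1 / 2)⁻¹ with hc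
  have hc0 : 0 < c := by positivity
  have hcR : c * R < 1 := by rw [hc, inv_mul_lt_iff₀ (by positivity)]; linarith
  have hcR' : 1 < c * (R + 1) := by rw [hc, lt_inv_mul_iff₀ (by positivity)]; linarith
  obtain ⟨A, hA⟩ := exists_abs_eval_le_mul_pow P hc0
  have hsmall : ∀ᶠ N : ℕ in atTop, (c * R) ^ N * B < ε := by
    have := (tendsto_pow_atTop_nhds_zero_of_lt_one (by positivity) hcR).mul_const B
    rw [zero_mul] at this
    exact this.eventually_lt_const hε
  have hlarge := (tendsto_pow_atTop_atTop_of_one_lt hcR').eventually_gt_atTop A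
  obtain ⟨N, hN, hN', hNd⟩ := (((tendsto_id.nsmul_atTop two_pos).eventually hsmall).and
    (hlarge.and (eventually_ge_atTop P.natDegree))).exists
  simp only [id, smul_eq_mul] at hN
  refine ⟨P + (C c ^ N * X ^ N) ^ 2 * h, S.add_mem hPS (hS _ _ hh), fun x => ?_⟩
  have hev : (P + (C c ^ N * X ^ N) ^ 2 * h).eval x
      = P.eval x + (c * |x|) ^ (2 * N) * h.eval x := by
    simp only [eval_add, eval_mul, eval_pow, eval_C, eval_X]
    rw [mul_pow c |x|, pow_mul |x|, sq_abs, ← pow_mul x, pow_mul c]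
    ring
  rw [hev]
  rcases le_total |x| R with hx | hx
  · have hxI : x ∈ Set.Icc (-(R + 1)) (R + 1) := abs_le.1 (hx.trans (by linarith))
    have h1 : |(c * |x|) ^ (2 * N) * h.eval x| ≤ (c * R) ^ (2 * N) * B := by
      rw [abs_mul, abs_of_nonneg (by positivity)]
      have := hB x hxI
      rw [Real.norm_eq_abs] at this
      gcongr
    linarith [hPε x hxI, neg_abs_le ((c * |x|) ^ (2 * N) * h.eval x)]
  · have h1 := hR x hx
    rcases le_total |x| (R + 1) with hx' | hx'
    · have := hP x (abs_le.1 hx')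
      positivity
    · have hu : c * (R + 1) ≤ c * |x| := by gcongr
      have hu1 : 1 ≤ c * |x| := hcR'.le.trans hu
      have h2 : |P.eval x| < (c * |x|) ^ (2 * N) := by
        calc |P.eval x| ≤ A * (c * |x|) ^ P.natDegree := hA x hu1
          _ < (c * |x|) ^ N * (c * |x|) ^ P.natDegree := by
            have : (c * (R + 1)) ^ N ≤ (c * |x|) ^ N := by gcongr
            gcongr
            exact hN'.trans_le this
          _ ≤ (c * |x|) ^ N * (c * |x|) ^ N := by gcongr
          _ = (c * |x|) ^ (2 * N) := by rw [two_mul, pow_add]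
      have h3 : (c * |x|) ^ (2 * N) ≤ (c * |x|) ^ (2 * N) * h.eval x :=
        le_mul_of_one_le_right (by positivity) h1
      linarith [neg_abs_le (P.eval x)]

end Polynomial

/-! ### Diagonalization by congruence -/

/-- Over an integral domain in which `2 ≠ 0`, a symmetric matrix is diagonalized by a congruence
with nonzero determinant. -/
theorem Matrix.IsSymm.exists_transpose_mul_mul_eq_diagonal {R n : Type*} [CommRing R] [IsDomain R]
    [Fintype n] [DecidableEq n] (h2 : (2 : R) ≠ 0) {f : Matrix n n R} (hf : f.IsSymm) :
    ∃ (W : Matrix n n R) (d : n → R), W.det ≠ 0 ∧ Wᵀ * f * W = Matrix.diagonal d := by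
  let K := FractionRing R
  have hinj : Function.Injective (algebraMap R K) := IsFractionRing.injective R K
  have h2K : (2 : K) ≠ 0 := by
    rw [← map_ofNat (algebraMap R K) 2]
    exact (map_ne_zero_iff _ hinj).2 h2
  let _ : Invertible (2 : K) := invertibleOfNonzero h2K
  set F : Matrix n n K := f.map (algebraMap R K) with hF
  have hFs : F.toBilin'.IsSymm := Matrix.isSymm_toBilin'_iff_isSymm.2 (hf.map _)
  obtain ⟨v₀, hv₀⟩ := LinearMap.BilinForm.exists_orthogonal_basis
    (LinearMap.BilinForm.isSymm_iff.1 hFs)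
  let e : Fin (Module.finrank K (n → K)) ≃ n := Fintype.equivOfCardEq (by simp)
  let v := v₀.reindex e
  have hv : ∀ i j, i ≠ j → v i ⬝ᵥ F *ᵥ v j = 0 := fun i j hij => by
    rw [← Matrix.toBilin'_apply', Module.Basis.reindex_apply, Module.Basis.reindex_apply]
    exact hv₀ (e.symm.injective.ne hij)
  let V : Matrix n n K := (Pi.basisFun K n).toMatrix v
  have hVapp : ∀ i j, V i j = v j i := fun i j => rfl
  have hVdet : V.det ≠ 0 := by
    let _ := (Pi.basisFun K n).invertibleToMatrix v
    exact (Matrix.isUnit_det_of_invertible V).ne_zero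
  -- A common denominator `b` brings the orthogonal basis over the fraction field back to `R`.
  obtain ⟨b, hb⟩ := IsLocalization.exist_integer_multiples_of_finite (nonZeroDivisors R)
    (fun ij : n × n => V ij.1 ij.2)
  choose w hw using hb
  have hb0 : algebraMap R K b ≠ 0 :=
    (map_ne_zero_iff _ hinj).2 (nonZeroDivisors.ne_zero b.2)
  let W : Matrix n n R := Matrix.of fun i j => w (i, j)
  have hW : W.map (algebraMap R K) = algebraMap R K b • V := by
    ext i j
    simpa [W, Algebra.smul_def] using hw (i, j)
  refine ⟨W, fun i => (Wᵀ * f * W) i i, fun h0 => ?_, ?_⟩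
  · have h1 := congrArg (algebraMap R K) h0
    rw [RingHom.map_det, map_zero, RingHom.mapMatrix_apply, hW, Matrix.det_smul] at h1
    exact mul_ne_zero (pow_ne_zero _ hb0) hVdet h1
  · ext i j
    rcases eq_or_ne i j with rfl | hij
    · simp
    · rw [Matrix.diagonal_apply_ne _ hij]
      refine hinj ?_
      rw [map_zero]
      have h1 : algebraMap R K ((Wᵀ * f * W) i j)
          = ((W.map (algebraMap R K))ᵀ * F * W.map (algebraMap R K)) i j := by
        rw [hF, ← Matrix.transpose_map, ← Matrix.map_mul, ← Matrix.map_mul, Matrix.map_apply]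
      have h3 : (Vᵀ * F * V) i j = v i ⬝ᵥ F *ᵥ v j := by
        rw [Matrix.mul_assoc, Matrix.mul_apply]; rfl
      rw [h1, hW, Matrix.transpose_smul, Matrix.mul_smul, Matrix.smul_mul, Matrix.smul_mul,
        Matrix.smul_apply, Matrix.smul_apply, h3, hv i j hij, smul_zero, smul_zero]

/-- Elements of the additive monoid generated by a family are finite sums of its members. -/
theorem AddSubmonoid.exists_fin_sum_of_mem_closure_range {M α : Type*} [AddCommMonoid M]
    {φ : α → M} {x : M} (hx : x ∈ AddSubmonoid.closure (Set.range φ)) :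
    ∃ (m : ℕ) (a : Fin m → α), x = ∑ i, φ (a i) := by
  induction hx using AddSubmonoid.closure_induction with
  | mem x hx => obtain ⟨a, rfl⟩ := hx; exact ⟨1, fun _ => a, by simp⟩
  | zero => exact ⟨0, Fin.elim0, by simp⟩
  | add x y _ _ ihx ihy =>
    obtain ⟨m, a, rfl⟩ := ihx
    obtain ⟨n, b, rfl⟩ := ihy
    exact ⟨m + n, Fin.append a b, by simp [Fin.sum_univ_add]⟩

/-! ### The quadratic form of a matrix polynomial -/

namespace MatPoly

variable {t : ℕ} {f : Matrix (Fin t) (Fin t) ℝ[X]}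

theorem evalAt_eq_mapMatrix (f : Matrix (Fin t) (Fin t) ℝ[X]) (x : ℝ) :
    evalAt f x = (Polynomial.evalRingHom x).mapMatrix f := rfl

theorem evalAt_transpose (f : Matrix (Fin t) (Fin t) ℝ[X]) (x : ℝ) :
    evalAt fᵀ x = (evalAt f x)ᵀ := rfl

theorem evalAt_mul (f g : Matrix (Fin t) (Fin t) ℝ[X]) (x : ℝ) :
    evalAt (f * g) x = evalAt f x * evalAt g x := by
  simp only [evalAt_eq_mapMatrix, map_mul]

theorem eval_dotProduct_mulVec (v : Fin t → ℝ[X]) (x : ℝ) :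
    (v ⬝ᵥ f *ᵥ v).eval x
      = (fun i => (v i).eval x) ⬝ᵥ evalAt f x *ᵥ fun i => (v i).eval x := by
  simp [dotProduct, Matrix.mulVec, Polynomial.eval_finsetSum, evalAt]

/-- If `f(x)` is negative semidefinite for no large `x`, then some polynomial vector witnesses
this near `+∞`. -/
theorem exists_eventually_atTop_pos (hf : f.IsSymm)
    (h : ∀ x : ℝ, ¬ (evalAt f x).IsNegSemidef) :
    ∃ v : Fin t → ℝ[X], ∀ᶠ x in atTop, 0 < (v ⬝ᵥ f *ᵥ v).eval x := by
  obtain ⟨W, d, hW, hd⟩ := hf.exists_transpose_mul_mul_eq_diagonal two_ne_zero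
  suffices hi : ∃ i, ∀ᶠ x in atTop, 0 < (d i).eval x by
    obtain ⟨i, hi⟩ := hi
    refine ⟨Wᵀ i, ?_⟩
    have : Wᵀ i ⬝ᵥ f *ᵥ Wᵀ i = d i := by
      rw [← Matrix.diagonal_apply_eq d i, ← hd, Matrix.mul_assoc, Matrix.mul_apply]; rfl
    rwa [this]
  -- A polynomial has constant weak sign near `+∞`, so otherwise every `d i` is eventually
  -- nonpositive. At a large `x` with `det W(x) ≠ 0`, `f(x)` is then congruent to a negative
  -- semidefinite diagonal matrix.
  by_contra! hcon
  have hall : ∀ᶠ x in atTop, ∀ i, (d i).eval x ≤ 0 := eventually_all.2 fun i =>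
    Polynomial.eventually_nonpos_of_not_eventually_pos (not_eventually.2 <| (hcon i).mono fun x => not_lt.2)
  obtain ⟨x, hx, hdet⟩ := (hall.and (Polynomial.eventually_atTop_not_isRoot W.det hW)).exists
  refine h x ?_
  have hunit : IsUnit (evalAt W x) := by
    rw [Matrix.isUnit_iff_isUnit_det, evalAt_eq_mapMatrix, ← RingHom.map_det]
    exact isUnit_iff_ne_zero.2 hdet
  have hdiag : (evalAt W x)ᵀ * evalAt f x * evalAt W x
      = Matrix.diagonal fun i => (d i).eval x := by
    rw [← evalAt_transpose, ← evalAt_mul, ← evalAt_mul, hd]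
    simp [evalAt, Matrix.diagonal_map]
  rw [Matrix.IsNegSemidef, ← Matrix.IsUnit.posSemidef_star_left_conjugate_iff hunit, Matrix.star_eq_conjTranspose,
    Matrix.conjTranspose_eq_transpose_of_trivial, Matrix.mul_neg, Matrix.neg_mul, hdiag,
    Matrix.diagonal_neg, Matrix.posSemidef_diagonal_iff]
  exact fun i => neg_nonneg.2 (hx i)

theorem exists_eventually_atBot_pos (hf : f.IsSymm)
    (h : ∀ x : ℝ, ¬ (evalAt f x).IsNegSemidef) :
    ∃ v : Fin t → ℝ[X], ∀ᶠ x in atBot, 0 < (v ⬝ᵥ f *ᵥ v).eval x := by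
  have hev : ∀ x, evalAt (f.map fun p => p.comp (-Polynomial.X)) x = evalAt f (-x) := fun x => by
    ext i j; simp [evalAt]
  obtain ⟨v, hv⟩ := exists_eventually_atTop_pos (hf.map fun p => p.comp (-Polynomial.X))
    (fun x => by rw [hev]; exact h (-x))
  refine ⟨fun i => (v i).comp (-Polynomial.X), ?_⟩
  filter_upwards [tendsto_neg_atBot_atTop.eventually hv] with x hx
  rw [eval_dotProduct_mulVec, hev, neg_neg] at hx
  rw [eval_dotProduct_mulVec]
  simpa using hx

theorem exists_dotProduct_mulVec_pos (hf : f.IsSymm) {x : ℝ}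
    (h : ¬ (evalAt f x).IsNegSemidef) :
    ∃ v : Fin t → ℝ[X], 0 < (v ⬝ᵥ f *ᵥ v).eval x := by
  by_contra! hcon
  refine h (Matrix.PosSemidef.of_dotProduct_mulVec_nonneg ?_ fun u => ?_)
  · rw [Matrix.IsHermitian, Matrix.conjTranspose_eq_transpose_of_trivial, Matrix.transpose_neg,
      ← evalAt_transpose, hf.eq]
  · have := hcon fun i => Polynomial.C (u i)
    rw [eval_dotProduct_mulVec] at this
    simpa [Matrix.neg_mulVec] using this

/-- A symmetric matrix polynomial which is nowhere negative semidefinite represents, by a sum of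
values of its quadratic form, a polynomial that is positive on the real line. -/
theorem exists_forall_eval_pos (hf : f.IsSymm) (h : ∀ x : ℝ, ¬ (evalAt f x).IsNegSemidef) :
    ∃ p ∈ AddSubmonoid.closure (Set.range fun v : Fin t → ℝ[X] => v ⬝ᵥ f *ᵥ v),
      ∀ x, 0 < p.eval x := by
  have mem : ∀ v : Fin t → ℝ[X], v ⬝ᵥ f *ᵥ v ∈
      AddSubmonoid.closure (Set.range fun v : Fin t → ℝ[X] => v ⬝ᵥ f *ᵥ v) :=
    fun v => AddSubmonoid.subset_closure ⟨v, rfl⟩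
  have hS : ∀ q : ℝ[X], ∀ g ∈ AddSubmonoid.closure
      (Set.range fun v : Fin t → ℝ[X] => v ⬝ᵥ f *ᵥ v), q ^ 2 * g ∈
      AddSubmonoid.closure (Set.range fun v : Fin t → ℝ[X] => v ⬝ᵥ f *ᵥ v) := by
    intro q g hg
    induction hg using AddSubmonoid.closure_induction with
    | mem g hg =>
      obtain ⟨v, rfl⟩ := hg
      refine AddSubmonoid.subset_closure ⟨q • v, ?_⟩
      simp only [Matrix.mulVec_smul, smul_dotProduct, dotProduct_smul, smul_eq_mul]
      ring
    | zero => rw [mul_zero]; exact zero_mem _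
    | add g g' _ _ ih ih' => rw [mul_add]; exact add_mem ih ih'
  obtain ⟨v₁, h₁⟩ := exists_eventually_atTop_pos hf h
  obtain ⟨v₂, h₂⟩ := exists_eventually_atBot_pos hf h
  obtain ⟨g, hg, htop, hbot⟩ :=
    Polynomial.exists_tendsto_of_eventually_pos hS (mem v₁) (mem v₂) h₁ h₂
  refine Polynomial.exists_forall_eval_pos hS (fun x => ?_) hg htop hbot
  obtain ⟨v, hv⟩ := exists_dotProduct_mulVec_pos hf (h x)
  exact ⟨_, mem v, hv⟩

/-- For `p = v eₖᵀ`, `pᵀ f p` is `vᵀ f v` times the diagonal matrix unit at `k`; summing over `k`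
gives the identity. -/
theorem smul_one_mem_closure {g : ℝ[X]}
    (hg : g ∈ AddSubmonoid.closure (Set.range fun v : Fin t → ℝ[X] => v ⬝ᵥ f *ᵥ v)) :
    g • (1 : Matrix (Fin t) (Fin t) ℝ[X]) ∈
      AddSubmonoid.closure (Set.range fun p : Matrix (Fin t) (Fin t) ℝ[X] => pᵀ * f * p) := by
  induction hg using AddSubmonoid.closure_induction with
  | mem g hg =>
    obtain ⟨v, rfl⟩ := hg
    have : (v ⬝ᵥ f *ᵥ v) • (1 : Matrix (Fin t) (Fin t) ℝ[X]) =
        ∑ k, (Matrix.vecMulVec v (Pi.single k 1))ᵀ * f * Matrix.vecMulVec v (Pi.single k 1) := by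
      have hk : ∀ k : Fin t,
          (Matrix.vecMulVec v (Pi.single k 1))ᵀ * f * Matrix.vecMulVec v (Pi.single k 1)
            = (v ⬝ᵥ f *ᵥ v) • Matrix.single k k 1 := fun k => by
        rw [Matrix.transpose_vecMulVec, Matrix.mul_assoc, Matrix.mul_vecMulVec,
          Matrix.vecMulVec_mul_vecMulVec, Matrix.vecMulVec_smul]
        congr 1
        rw [Matrix.single_eq_single_vecMulVec_single]
      simp_rw [hk]
      rw [← Finset.smul_sum, Matrix.sum_single_one]
    rw [this]
    exact sum_mem fun k _ => AddSubmonoid.subset_closure ⟨_, rfl⟩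
  | zero => rw [zero_smul]; exact zero_mem _
  | add g g' _ _ ih ih' => rw [add_smul]; exact add_mem ih ih'

theorem isSumHermitianSquares_smul_one {g : ℝ[X]} (hg : IsSumSq g) :
    IsSumHermitianSquares (g • (1 : Matrix (Fin t) (Fin t) ℝ[X])) := by
  refine AddSubmonoid.exists_fin_sum_of_mem_closure_range
    (φ := fun q : Matrix (Fin t) (Fin t) ℝ[X] => qᵀ * q) ?_
  induction hg with
  | zero => rw [zero_smul]; exact zero_mem _
  | sq_add a _ ih =>
    rw [add_smul]
    refine add_mem (AddSubmonoid.subset_closure ⟨a • 1, ?_⟩) ih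
    simp [smul_smul]

end MatPoly

/-! ### The equivalence -/

theorem theorem4 (t : ℕ) (ht : 1 ≤ t) (f : Matrix (Fin t) (Fin t) (Polynomial ℝ))
    (hf : f.IsSymm) :
    (∀ x : ℝ, ¬ (MatPoly.evalAt f x).IsNegSemidef) ↔
      ∃ (N : ℕ) (p : Fin N → Matrix (Fin t) (Fin t) (Polynomial ℝ)),
        MatPoly.IsSumHermitianSquares ((∑ i, (p i)ᵀ * f * p i) - 1) := by
  constructor
  · intro h
    obtain ⟨g, hg, hpos⟩ := MatPoly.exists_forall_eval_pos hf h
    obtain ⟨a, ha⟩ := Polynomial.exists_forall_eval_le_of_nonneg g fun x => (hpos x).le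
    obtain ⟨N, p, hp⟩ :=
      AddSubmonoid.exists_fin_sum_of_mem_closure_range (MatPoly.smul_one_mem_closure hg)
    have hm := hpos a
    -- This scaling makes the minimum of `c² g` equal to 1.
    set c := (√(g.eval a))⁻¹ with hc
    have hcc : c * c = (g.eval a)⁻¹ := by rw [hc, ← mul_inv, Real.mul_self_sqrt hm.le]
    refine ⟨N, fun i => Polynomial.C c • p i, ?_⟩
    have hsum : ∑ i, (Polynomial.C c • p i)ᵀ * f * (Polynomial.C c • p i) - 1
        = (Polynomial.C (c * c) * g - 1) • (1 : Matrix (Fin t) (Fin t) ℝ[X]) := by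
      rw [sub_smul, one_smul, mul_smul, hp, Finset.smul_sum]
      congr 1
      refine Finset.sum_congr rfl fun i _ => ?_
      rw [Matrix.transpose_smul, Matrix.smul_mul, Matrix.smul_mul, Matrix.mul_smul, smul_smul,
        Polynomial.C_mul]
    rw [hsum]
    refine MatPoly.isSumHermitianSquares_smul_one (Polynomial.isSumSq_of_eval_nonneg _ fun x => ?_)
    rw [Polynomial.eval_sub, Polynomial.eval_mul, Polynomial.eval_C, Polynomial.eval_one, hcc,
      sub_nonneg, le_inv_mul_iff₀ hm, mul_one]
    exact ha x
  · rintro ⟨N, p, m, q, hq⟩ x hx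
    have hev : ∑ i, (MatPoly.evalAt (p i) x)ᵀ * MatPoly.evalAt f x * MatPoly.evalAt (p i) x - 1
        = ∑ j, (MatPoly.evalAt (q j) x)ᵀ * MatPoly.evalAt (q j) x := by
      have := congrArg (Polynomial.evalRingHom x).mapMatrix hq
      simp only [map_sub, map_sum, map_one] at this
      simpa only [← MatPoly.evalAt_eq_mapMatrix, MatPoly.evalAt_mul, MatPoly.evalAt_transpose]
        using this
    have h1 : (∑ i, (MatPoly.evalAt (p i) x)ᵀ * -MatPoly.evalAt f x *
        MatPoly.evalAt (p i) x).PosSemidef :=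
      Matrix.posSemidef_sum _ fun i _ => by
        simpa using Matrix.PosSemidef.conjTranspose_mul_mul_same hx (MatPoly.evalAt (p i) x)
    have h2 : (∑ j, (MatPoly.evalAt (q j) x)ᵀ * MatPoly.evalAt (q j) x).PosSemidef :=
      Matrix.posSemidef_sum _ fun j _ => by
        simpa using Matrix.posSemidef_conjTranspose_mul_self (MatPoly.evalAt (q j) x)
    rw [← hev] at h2
    -- The two semidefinite matrices add up to `-1`; `1 ≤ t` supplies a diagonal entry to
    -- contradict.
    have h3 := (h1.add h2).diag_nonneg (i := (⟨0, ht⟩ : Fin t))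
    simp only [Matrix.mul_neg, Matrix.neg_mul, Finset.sum_neg_distrib] at h3
    rw [neg_add_eq_sub, sub_sub_cancel_left, Matrix.neg_apply, Matrix.one_apply_eq] at h3
    linarith
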